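/- Let $n\ge 2$. For $A\in\mathbb R^{n\times n}$ put $\|A\|_\triangle=\big(\sum_{i\le j}A_{ij}^2\big)^{1/2}$; write $\|x\|_A^2=x^\top A x$, let $\mathbf 1$ be the all-ones vector, and let vector inequalities and intervals be componentwise. The controller is given: $v^{\rm nom},\underline v,\overline v,\underline q,\overline q\in\mathbb R^n$ with $\underline q\ne\overline q$; positive semidefinite matrices $P_v,P_u$; $\beta>0$; a noise bound $\eta$; a padding $\varepsilon$; and sets $\mathcal X\subset\mathbb R^{n\times n}$, $\mathcal V^{\rm par}\subset\mathbb R^n$. Let $$\rho=\frac{\varepsilon}{2\|\overline q-\underline q\|_2},\qquad m=\frac{n(n+1)}2,\qquad \gamma=\pi(m-1)m^{m/2},\qquad \operatorname{diam}(\mathcal X)=\sup_{X_1,X_2\in\mathcal X}\|X_1-X_2\|_\triangle .$$ System. For an unknown matrix $X^\star$ and an unknown sequence $v^{\rm par}(t)$, $t\ge0$, the (squared) voltages satisfy $v(1)=X^\star q^c(0)+v^{\rm par}(0)$, with $q^c(0)\in[\underline q,\overline q]$ given, and, for $t\ge1$, $v(t+1)=v(t)+X^\star u(t)+w(t)$,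 where $u(t)=q^c(t)-q^c(t-1)$ is the control action and $w(t)=v^{\rm par}(t)-v^{\rm par}(t-1)$. Assumptions. (1) $\|w(t)\|_\infty\le\eta$ for all $t\ge1$, where $0\le\eta\le\min_i(\overline v_i-\underline v_i)/2$. (2) $\mathcal X$ is a compact convex set of symmetric positive semidefinite matrices with nonnegative entries, and $X^\star\in\mathcal X$. (3) $\mathcal V^{\rm par}$ is compact and convex, $v^{\rm par}(t)\in\mathcal V^{\rm par}$ for all $t\ge0$, $\varepsilon>0$, and for all $p\in\mathcal V^{\rm par}$, $X\in\mathcal X$ there is $q\in[\underline q,\overline q]$ with $Xq+p\in[\underline v+(\eta+\varepsilon)\mathbf 1,\ \overline v-(\eta+\varepsilon)\mathbf 1]$. Algorithm. The initial estimate $\hat X_1\in\mathcal X$ is arbitrary. At each time $t\ge 2$ the estimate $\hat X_t$ is a minimizer of $\|X-\hat X_{t-1}\|_\triangle^2$ over all $X\in\mathcal X$ such that, for all $1\le i\le t-1$, $-\eta\mathbf 1\le v(i+1)-v(i)-Xu(i)\le\eta\mathbf 1$ and $v(i+1)-Xq^c(i)\in\mathcal V^{\rm par}$. At each time $t\ge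 1$ the action $u(t)$ is then chosen by the robust oracle: consider, for a slack $\xi\ge0$, the constraints $$\underline q\le q^c(t-1)+u\le\overline q,\qquad \underline v+(k-\xi)\mathbf 1\le v(t)+\hat X_tu\le\overline v-(k-\xi)\mathbf 1,\qquad k=\eta+\rho\|u\|_2 .$$ If they are feasible with $\xi=0$, then $u(t)$ is any minimizer of $\|v(t)+\hat X_tu-v^{\rm nom}\|_{P_v}^2+\|u\|_{P_u}^2$ subject to them with $\xi=0$; otherwise $(u(t),\xi)$ is any minimizer of the same cost plus $\beta\xi^2$ over $u\in\mathbb R^n$, $\xi\ge0$. Theorem. Under these assumptions, every run of the algorithm violates the voltage limits at most $$\frac{4\gamma}{\rho}\operatorname{diam}(\mathcal X)+1$$ times, i.e. the number of times $t\ge1$ with $v(t)\notin[\underline v,\overline v]$ is finite and bounded by this quantity. -/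

import Mathlib

open Matrix Set

noncomputable section

namespace VoltageControl

/-- The norm `‖A‖_△`: the Euclidean norm of the upper triangle (diagonal included) of `A`. -/
def triNorm {n : ℕ} (A : Matrix (Fin n) (Fin n) ℝ) : ℝ :=
  Real.sqrt (∑ i, ∑ j ∈ Finset.Ici i, A i j ^ 2)

/-- The diameter of a set of matrices in the norm `‖·‖_△`. -/
def triDiam {n : ℕ} (S : Set (Matrix (Fin n) (Fin n) ℝ)) : ℝ :=
  sSup {d : ℝ | ∃ X₁ ∈ S, ∃ X₂ ∈ S, d = triNorm (X₁ - X₂)}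

/-- The Euclidean norm of a vector (the norm of `Fin n → ℝ` itself is the sup norm). -/
def l2norm {n : ℕ} (x : Fin n → ℝ) : ℝ :=
  ‖(WithLp.toLp 2 x : EuclideanSpace ℝ (Fin n))‖

/-- The weighted squared seminorm `‖x‖_A² = xᵀ A x`. -/
def quadForm {n : ℕ} (A : Matrix (Fin n) (Fin n) ℝ) (x : Fin n → ℝ) : ℝ :=
  x ⬝ᵥ (A *ᵥ x)

/-- The constant vector `c 𝟏`. -/
def constVec (n : ℕ) (c : ℝ) : Fin n → ℝ := fun _ => c

/-- The dimension `m = n (n + 1) / 2` of the space of symmetric `n × n` matrices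
(the division is exact). -/
def symDim (n : ℕ) : ℕ := n * (n + 1) / 2

/-- The constant `γ = π (m - 1) m ^ (m / 2)` with `m = n (n + 1) / 2`. -/
def gammaConst (n : ℕ) : ℝ :=
  Real.pi * ((symDim n : ℝ) - 1) * (symDim n : ℝ) ^ ((symDim n : ℝ) / 2)

/-- The data known to the controller (apart from the initial state). -/
structure Input (n : ℕ) where
  /-- nominal squared voltage magnitudes -/
  vnom : Fin n → ℝ
  /-- lower limits on the squared voltage magnitudes -/
  vmin : Fin n → ℝ
  /-- upper limits on the squared voltage magnitudes -/
  vmax : Fin n → ℝ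
  /-- lower limits on the controllable reactive power injections -/
  qmin : Fin n → ℝ
  /-- upper limits on the controllable reactive power injections -/
  qmax : Fin n → ℝ
  /-- state cost matrix -/
  Pv : Matrix (Fin n) (Fin n) ℝ
  /-- action cost matrix -/
  Pu : Matrix (Fin n) (Fin n) ℝ
  /-- uncertainty set for the model parameter -/
  modelSet : Set (Matrix (Fin n) (Fin n) ℝ)
  /-- uncertainty set for the exogenous voltage quantities -/
  vparSet : Set (Fin n → ℝ)
  /-- bound on the change in noise -/
  η : ℝ
  /-- padding in the feasibility condition -/
  ε : ℝ
  /-- weight of the slack variable -/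
  β : ℝ

/-- One record `(v(i), v(i+1), u(i), q^c(i))` of the trajectory. -/
structure Observation (n : ℕ) where
  vCur : Fin n → ℝ
  vNext : Fin n → ℝ
  u : Fin n → ℝ
  qc : Fin n → ℝ

namespace Input

variable {n : ℕ} (I : Input n)

/-- `ρ(ε) = ε / (2 ‖q̄ - q̲‖₂)`. -/
def rho : ℝ := I.ε / (2 * l2norm (I.qmax - I.qmin))

/-- The change in noise is bounded: `‖v^par(t) - v^par(t-1)‖_∞ ≤ η` for all `t ≥ 1`, where
`0 ≤ η ≤ min_i (v̄_i - v̲_i) / 2`. The norm of `Fin n → ℝ` is the sup norm. -/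
structure NoiseBounded (vpar : ℕ → Fin n → ℝ) : Prop where
  eta_nonneg : 0 ≤ I.η
  eta_le : ∀ i, I.η ≤ (I.vmax i - I.vmin i) / 2
  change_le : ∀ t, ‖vpar (t + 1) - vpar t‖ ≤ I.η

/-- The true model lies in a compact convex set of positive semidefinite matrices with
nonnegative entries. -/
structure ModelUncertainty (Xstar : Matrix (Fin n) (Fin n) ℝ) : Prop where
  compact : IsCompact I.modelSet
  convex : Convex ℝ I.modelSet
  posSemidef : ∀ X ∈ I.modelSet, X.PosSemidef
  entry_nonneg : ∀ X ∈ I.modelSet, ∀ i j, 0 ≤ X i j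
  true_mem : Xstar ∈ I.modelSet

/-- The exogenous quantities stay in a compact convex set, and for each of its points and each
model in the uncertainty set some admissible injection brings the voltage into the limits padded
by `η + ε`. -/
structure PaddedFeasible (vpar : ℕ → Fin n → ℝ) : Prop where
  compact : IsCompact I.vparSet
  convex : Convex ℝ I.vparSet
  mem : ∀ t, vpar t ∈ I.vparSet
  eps_pos : 0 < I.ε
  feasible : ∀ p ∈ I.vparSet, ∀ X ∈ I.modelSet, ∃ q ∈ Icc I.qmin I.qmax,
    X *ᵥ q + p ∈ Icc (I.vmin + constVec n (I.η + I.ε)) (I.vmax - constVec n (I.η + I.ε))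

/-- The feasible set of the model chasing problem for the recorded trajectory `D`. -/
def consistentSet (D : List (Observation n)) : Set (Matrix (Fin n) (Fin n) ℝ) :=
  {X | X ∈ I.modelSet ∧ ∀ d ∈ D,
    d.vNext - d.vCur - X *ᵥ d.u ∈ Icc (constVec n (-I.η)) (constVec n I.η) ∧
    d.vNext - X *ᵥ d.qc ∈ I.vparSet}

/-- Greedy projection model chasing: `Xnew` solves
`min ‖X - Xprev‖_△²` over the models `X` consistent with `D`. -/
def IsSEL (D : List (Observation n)) (Xprev Xnew : Matrix (Fin n) (Fin n) ℝ) : Prop :=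
  Xnew ∈ I.consistentSet D ∧
    IsMinOn (fun X => triNorm (X - Xprev) ^ 2) (I.consistentSet D) Xnew

/-- The constraints of the control oracle with slack `ξ`, for the model `X`, the current voltage
`v` and the previous injection `q`. -/
def OracleConstraints (X : Matrix (Fin n) (Fin n) ℝ) (v q u : Fin n → ℝ) (ξ : ℝ) : Prop :=
  q + u ∈ Icc I.qmin I.qmax ∧
    v + X *ᵥ u ∈ Icc (I.vmin + constVec n (I.η + I.rho * l2norm u - ξ))
      (I.vmax - constVec n (I.η + I.rho * l2norm u - ξ))

/-- The feasible actions of the control oracle without slack. -/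
def oracleFeasible (X : Matrix (Fin n) (Fin n) ℝ) (v q : Fin n → ℝ) : Set (Fin n → ℝ) :=
  {u | I.OracleConstraints X v q u 0}

/-- The feasible pairs (action, slack) of the control oracle with slack. -/
def oracleSlackFeasible (X : Matrix (Fin n) (Fin n) ℝ) (v q : Fin n → ℝ) :
    Set ((Fin n → ℝ) × ℝ) :=
  {z | 0 ≤ z.2 ∧ I.OracleConstraints X v q z.1 z.2}

/-- The cost `‖v + X u - v^nom‖²_{P_v} + ‖u‖²_{P_u}`. -/
def oracleCost (X : Matrix (Fin n) (Fin n) ℝ) (v u : Fin n → ℝ) : ℝ :=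
  quadForm I.Pv (v + X *ᵥ u - I.vnom) + quadForm I.Pu u

/-- `u` is an action chosen by the robust control oracle: a minimizer of the problem without
slack if that problem is feasible, and otherwise the action of a minimizer of the problem
with slack. -/
def IsOracleAction (X : Matrix (Fin n) (Fin n) ℝ) (v q u : Fin n → ℝ) : Prop :=
  ((I.oracleFeasible X v q).Nonempty ∧
    u ∈ I.oracleFeasible X v q ∧ IsMinOn (I.oracleCost X v) (I.oracleFeasible X v q) u) ∨
  (¬ (I.oracleFeasible X v q).Nonempty ∧
    ∃ ξ : ℝ, (u, ξ) ∈ I.oracleSlackFeasible X v q ∧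
      IsMinOn (fun z : (Fin n → ℝ) × ℝ => I.oracleCost X v z.1 + I.β * z.2 ^ 2)
        (I.oracleSlackFeasible X v q) (u, ξ))

end Input

/-- The recorded trajectory `D_t = [(v(i), v(i+1), u(i), q^c(i))]` for `i = 1, …, t`. -/
def trajectory {n : ℕ} (v u qc : ℕ → Fin n → ℝ) (t : ℕ) : List (Observation n) :=
  (List.range t).map fun i => ⟨v (i + 1), v (i + 2), u (i + 1), qc (i + 1)⟩

/-- `(Xhat, v, u, qc)` is a run of the online robust voltage controller on the system with true
model `Xstar` and exogenous sequence `vpar`. Estimates `Xhat t`, voltages `v t` and actions `u t`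
are indexed by `t ≥ 1` (their values at `0` play no role); `qc t` and `vpar t` by `t ≥ 0`. -/
structure IsRun {n : ℕ} (I : Input n) (Xstar : Matrix (Fin n) (Fin n) ℝ) (vpar : ℕ → Fin n → ℝ)
    (Xhat : ℕ → Matrix (Fin n) (Fin n) ℝ) (v u qc : ℕ → Fin n → ℝ) : Prop where
  qc_init : qc 0 ∈ Icc I.qmin I.qmax
  v_init : v 1 = Xstar *ᵥ qc 0 + vpar 0
  Xhat_init : Xhat 1 ∈ I.modelSet
  sel : ∀ t, 1 ≤ t → I.IsSEL (trajectory v u qc t) (Xhat t) (Xhat (t + 1))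
  oracle : ∀ t, 1 ≤ t → I.IsOracleAction (Xhat t) (v t) (qc (t - 1)) (u t)
  qc_step : ∀ t, 1 ≤ t → qc t = qc (t - 1) + u t
  v_step : ∀ t, 1 ≤ t → v (t + 1) = v t + Xstar *ᵥ u t + (vpar t - vpar (t - 1))

end VoltageControl

end

/-!
After a step of the controller the new estimate explains the observed voltage change up to noise of
size `η`, while the oracle has planned with the old estimate and a margin `η + ρ ‖u‖₂`. Hence a
violation after a feasible oracle problem forces the estimate to move by more than `ρ`
(`next_mem_Icc`). The oracle is feasible from time `2` on, and at time `1` unless the initial model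
error exceeds `ρ`, in which case `ρ < diam 𝒳` (`IsRun.rho_lt_triDiam`). So there are at most
`1 + diam 𝒳 / ρ + L / ρ` violations, where `L` is the length of the path of the estimates, and
everything rests on a bound for `L`.

The estimates are successive projections to decreasing convex sets in a Euclidean space of dimension
`m = n (n + 1) / 2` (the upper triangles). Along such a path all later points are seen from each
`x t` under angles of at most `π / 2` (`IsProjectionPath.inner_nonneg`). A linear functional `θ` in
the dual cone of the later directions `x s - x t`, translated by a multiple `τ` of the step
direction, exceeds its value at `x t` by at least `τ ‖x (t + 1) - x t‖` on the rest of the path, so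
the minimum of `θ` over the rest of the path grows by that much at this step. Summing over the steps
and integrating over `θ` with respect to a Gaussian bounds `L` by the diameter
(`IsProjectionPath.length_le`), once the Gaussian mass of the dual cones is bounded below.

That lower bound, `6 ^ (-m / 2)` in proportion to the whole space, is `setIntegral_nonnegCone_ge`.
The dual cone `S` of a set with pairwise nonnegative inner products satisfies `S - S = E` with
orthogonal summands (Moreau decomposition), so each `x` has a whole translate of `S` of
representations as a difference of elements of `S`; comparing with the self-convolution of the
Gaussian of `S` gives `μ(S) ^ 2 ≥ 6 ^ (-m / 2) μ(E) μ(S)`. The resulting constant is `6 ^ (m / 2)`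
up to a factor linear in `m`, and is below `4 γ - 1` for all `m ≥ 3` that occur (`length_const_le`).
-/

namespace VoltageControl

/-! ### Cones with an acute generating set -/

section Cone

open MeasureTheory

variable {E : Type*} [NormedAddCommGroup E] [InnerProductSpace ℝ E]

/-- The cone of vectors with a nonnegative inner product with every element of `Z`, i.e. the dual
cone of `Z`. -/
def nonnegCone (Z : Set E) : Set E := {θ | ∀ z ∈ Z, 0 ≤ inner ℝ θ z}

lemma isClosed_nonnegCone (Z : Set E) : IsClosed (nonnegCone Z) := by
  have : nonnegCone Z = ⋂ z ∈ Z, {θ | 0 ≤ inner ℝ θ z} := by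
    ext; simp [nonnegCone]
  rw [this]
  exact isClosed_biInter fun z _ => isClosed_le continuous_const (by fun_prop)

lemma add_mem_nonnegCone {Z : Set E} {a b : E} (ha : a ∈ nonnegCone Z) (hb : b ∈ nonnegCone Z) :
    a + b ∈ nonnegCone Z := fun z hz => by
  rw [inner_add_left]; exact add_nonneg (ha z hz) (hb z hz)

lemma smul_mem_nonnegCone {Z : Set E} {a : E} {r : ℝ} (hr : 0 ≤ r) (ha : a ∈ nonnegCone Z) :
    r • a ∈ nonnegCone Z := fun z hz => by
  rw [real_inner_smul_left]; exact mul_nonneg hr (ha z hz)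

lemma zero_mem_nonnegCone (Z : Set E) : (0 : E) ∈ nonnegCone Z := fun z _ => by simp

lemma convex_nonnegCone (Z : Set E) : Convex ℝ (nonnegCone Z) :=
  fun _ ha _ hb _ _ hr hs _ =>
    add_mem_nonnegCone (smul_mem_nonnegCone hr ha) (smul_mem_nonnegCone hs hb)

/-- Moreau decomposition with respect to the dual cone of a set `Z` with pairwise nonnegative inner
products. Such a `Z` lies in its dual cone, so that the polar component, which pairs nonnegatively
with the whole dual cone, lies (up to sign) in the dual cone as well. -/
lemma exists_nonnegCone_decomposition [CompleteSpace E] {Z : Set E}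
    (hZ : ∀ y ∈ Z, ∀ z ∈ Z, 0 ≤ inner ℝ y z) (x : E) :
    ∃ a ∈ nonnegCone Z, ∃ b ∈ nonnegCone Z, x = a - b ∧ inner ℝ a b = 0 := by
  obtain ⟨a, ha, hmin⟩ := exists_norm_eq_iInf_of_complete_convex ⟨0, zero_mem_nonnegCone Z⟩
    (isClosed_nonnegCone Z).isComplete (convex_nonnegCone Z) x
  rw [norm_eq_iInf_iff_real_inner_le_zero (convex_nonnegCone Z) ha] at hmin
  have h0 := hmin 0 (zero_mem_nonnegCone Z)
  have h2 := hmin (a + a) (add_mem_nonnegCone ha ha)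
  simp only [zero_sub, inner_neg_right, add_sub_cancel_right] at h0 h2
  have horth : inner ℝ (x - a) a = 0 := by linarith
  refine ⟨a, ha, a - x, fun z hz => ?_, by abel, ?_⟩
  · have h := hmin z (hZ z hz)
    rw [inner_sub_right, horth, sub_zero] at h
    rw [← neg_sub x a, inner_neg_left]
    linarith
  · rw [real_inner_comm, ← neg_sub x a, inner_neg_left, horth, neg_zero]

variable [FiniteDimensional ℝ E] [MeasurableSpace E] [BorelSpace E]

lemma integrable_exp_neg_mul_sq_norm {b : ℝ} (hb : 0 < b) :
    Integrable fun v : E => Real.exp (-b * ‖v‖ ^ 2) := by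
  by_contra h
  have h1 := GaussianFourier.integral_rexp_neg_mul_sq_norm (V := E) hb
  rw [integral_undef h] at h1
  have : 0 < (Real.pi / b) ^ ((Module.finrank ℝ E : ℝ) / 2) := by positivity
  linarith

lemma setIntegral_nonnegCone_scale (Z : Set E) {b : ℝ} (hb : 0 < b) :
    ∫ v in nonnegCone Z, Real.exp (-b * ‖v‖ ^ 2) =
      (b ^ ((Module.finrank ℝ E : ℝ) / 2))⁻¹ * ∫ v in nonnegCone Z, Real.exp (-1 * ‖v‖ ^ 2) := by
  have hm := (isClosed_nonnegCone Z).measurableSet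
  rw [← integral_indicator hm, ← integral_indicator hm]
  have hs : 0 < √b := Real.sqrt_pos.2 hb
  have key := Measure.integral_comp_smul_of_nonneg (volume : Measure E)
    ((nonnegCone Z).indicator fun v : E => Real.exp (-1 * ‖v‖ ^ 2)) (√b) (hR := hs.le)
  have hpow : b ^ ((Module.finrank ℝ E : ℝ) / 2) = √b ^ Module.finrank ℝ E := by
    rw [Real.sqrt_eq_rpow, ← Real.rpow_natCast, ← Real.rpow_mul hb.le]
    congr 1; ring
  rw [hpow, ← smul_eq_mul, ← key]
  congr 1
  ext v
  have hiff : √b • v ∈ nonnegCone Z ↔ v ∈ nonnegCone Z := by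
    refine ⟨fun h => ?_, smul_mem_nonnegCone hs.le⟩
    have := smul_mem_nonnegCone (inv_nonneg.2 hs.le) h
    rwa [inv_smul_smul₀ hs.ne'] at this
  by_cases hv : v ∈ nonnegCone Z
  · rw [indicator_of_mem hv, indicator_of_mem (hiff.2 hv), norm_smul, mul_pow, Real.norm_eq_abs,
      sq_abs, Real.sq_sqrt hb.le]
    congr 1; ring
  · rw [indicator_of_notMem hv, indicator_of_notMem (mt hiff.1 hv)]

lemma setIntegral_nonnegCone_pos {Z : Set E} (hZ : ∀ y ∈ Z, ∀ z ∈ Z, 0 ≤ inner ℝ y z) {b : ℝ}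
    (hb : 0 < b) : 0 < ∫ v in nonnegCone Z, Real.exp (-b * ‖v‖ ^ 2) := by
  have hspan : affineSpan ℝ (nonnegCone Z) = ⊤ := by
    rw [AffineSubspace.affineSpan_eq_top_iff_vectorSpan_eq_top_of_nonempty ℝ E E
      ⟨0, zero_mem_nonnegCone Z⟩]
    refine eq_top_iff.2 fun x _ => ?_
    obtain ⟨a, ha, b, hb, rfl, -⟩ := exists_nonnegCone_decomposition hZ x
    exact vsub_mem_vectorSpan ℝ ha hb
  have hint := (convex_nonnegCone Z).interior_nonempty_iff_affineSpan_eq_top.2 hspan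
  have hpos : 0 < volume (nonnegCone Z) :=
    (isOpen_interior.measure_pos volume hint).trans_le (measure_mono interior_subset)
  rw [setIntegral_pos_iff_support_of_nonneg_ae (ae_of_all _ fun v => (Real.exp_pos _).le)
    (integrable_exp_neg_mul_sq_norm hb).integrableOn]
  have : (Function.support fun v : E => Real.exp (-b * ‖v‖ ^ 2)) = univ := by
    ext v; simp [(Real.exp_pos _).ne']
  rwa [this, univ_inter]

/-- The self-convolution of the Gaussian of the dual cone, bounded below through the Moreau
decomposition `x = a - b`: the pairs `(a + s, b + s)` with `s` in the cone are pairs of elements of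
the cone with difference `x`. -/
lemma sq_setIntegral_nonnegCone_ge {Z : Set E} (hZ : ∀ y ∈ Z, ∀ z ∈ Z, 0 ≤ inner ℝ y z) :
    (∫ v : E, Real.exp (-2 * ‖v‖ ^ 2)) * ∫ v in nonnegCone Z, Real.exp (-3 * ‖v‖ ^ 2) ≤
      (∫ v in nonnegCone Z, Real.exp (-1 * ‖v‖ ^ 2)) ^ 2 := by
  set S := nonnegCone Z with hS
  have hm : MeasurableSet S := (isClosed_nonnegCone Z).measurableSet
  let F (b : ℝ) : E → ENNReal := S.indicator fun v => ENNReal.ofReal (Real.exp (-b * ‖v‖ ^ 2))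
  have hFm (b : ℝ) : Measurable (F b) := (by fun_prop : Measurable fun v : E =>
    ENNReal.ofReal (Real.exp (-b * ‖v‖ ^ 2))).indicator hm
  have hF {b : ℝ} (hb : 0 < b) :
      ∫⁻ v, F b v = ENNReal.ofReal (∫ v in S, Real.exp (-b * ‖v‖ ^ 2)) := by
    rw [lintegral_indicator hm, ofReal_integral_eq_lintegral_ofReal
      (integrable_exp_neg_mul_sq_norm hb).integrableOn (ae_of_all _ fun v => (Real.exp_pos _).le)]
  have hpoint (x : E) : ENNReal.ofReal (Real.exp (-2 * ‖x‖ ^ 2)) * ∫⁻ s, F 3 s ≤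
      ∫⁻ y, F 1 y * F 1 (y - x) := by
    obtain ⟨a, ha, b, hb, rfl, hab⟩ := exists_nonnegCone_decomposition hZ x
    rw [← lintegral_add_left_eq_self (fun y => F 1 y * F 1 (y - (a - b))) a,
      ← lintegral_const_mul _ (hFm 3)]
    refine lintegral_mono fun s => ?_
    by_cases hs : s ∈ S
    · have h1 : a + s ∈ S := add_mem_nonnegCone ha hs
      have h2 : a + s - (a - b) ∈ S := by
        rw [show a + s - (a - b) = b + s by abel]; exact add_mem_nonnegCone hb hs
      simp only [F, indicator_of_mem hs, indicator_of_mem h1, indicator_of_mem h2]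
      rw [← ENNReal.ofReal_mul (Real.exp_pos _).le, ← ENNReal.ofReal_mul (Real.exp_pos _).le,
        ← Real.exp_add, ← Real.exp_add]
      refine ENNReal.ofReal_le_ofReal (Real.exp_le_exp.2 ?_)
      rw [show a + s - (a - b) = b + s by abel]
      have e1 := norm_add_sq_real a s
      have e2 := norm_add_sq_real b s
      have e3 := norm_sub_sq_real a b
      have e4 := norm_sub_sq_real (a + b) s
      have e5 := norm_add_sq_real a b
      rw [inner_add_left] at e4
      nlinarith [sq_nonneg ‖a + b - s‖]
    · simp only [F, indicator_of_notMem hs, mul_zero, zero_le]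
  have hconv : (∫⁻ v, F 1 v) ^ 2 = ∫⁻ x, ∫⁻ y, F 1 y * F 1 (y - x) := by
    rw [lintegral_lintegral_swap
      (((hFm 1).comp measurable_snd).mul
        ((hFm 1).comp (measurable_snd.sub measurable_fst))).aemeasurable]
    have (y : E) : ∫⁻ x, F 1 y * F 1 (y - x) = F 1 y * ∫⁻ v, F 1 v := by
      rw [lintegral_const_mul (f := fun x => F 1 (y - x)) _
        ((hFm 1).comp (measurable_const.sub measurable_id)), lintegral_sub_left_eq_self (F 1) y]
    simp_rw [this]
    rw [lintegral_mul_const _ (hFm 1), sq]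
  have hmain : (∫⁻ v : E, ENNReal.ofReal (Real.exp (-2 * ‖v‖ ^ 2))) * ∫⁻ s, F 3 s ≤
      (∫⁻ v, F 1 v) ^ 2 := by
    rw [hconv, ← lintegral_mul_const _ (by fun_prop)]
    exact lintegral_mono hpoint
  have hnn (b : ℝ) : 0 ≤ ∫ v in S, Real.exp (-b * ‖v‖ ^ 2) :=
    integral_nonneg fun v => (Real.exp_pos _).le
  rw [hF three_pos, hF one_pos, ← ofReal_integral_eq_lintegral_ofReal
    (integrable_exp_neg_mul_sq_norm two_pos) (ae_of_all _ fun v => (Real.exp_pos _).le),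
    ← ENNReal.ofReal_mul (integral_nonneg fun v => (Real.exp_pos _).le),
    ← ENNReal.ofReal_pow (hnn 1), ENNReal.ofReal_le_ofReal_iff (by positivity)] at hmain
  exact hmain

/-- The dual cone of a set with pairwise nonnegative inner products carries at least the fraction
`6 ^ (-m / 2)` of the Gaussian mass of an `m`-dimensional space. -/
lemma setIntegral_nonnegCone_ge {Z : Set E} (hZ : ∀ y ∈ Z, ∀ z ∈ Z, 0 ≤ inner ℝ y z) :
    (Real.pi / 6) ^ ((Module.finrank ℝ E : ℝ) / 2) ≤
      ∫ v in nonnegCone Z, Real.exp (-1 * ‖v‖ ^ 2) := by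
  have h := sq_setIntegral_nonnegCone_ge hZ
  have hpos := setIntegral_nonnegCone_pos hZ one_pos
  rw [setIntegral_nonnegCone_scale Z three_pos,
    GaussianFourier.integral_rexp_neg_mul_sq_norm two_pos, ← mul_assoc, sq] at h
  have h' := le_of_mul_le_mul_right h hpos
  refine le_trans (le_of_eq ?_) h'
  rw [← Real.inv_rpow (by norm_num), ← Real.mul_rpow (by positivity) (by norm_num)]
  congr 1; ring

/-- The Gaussian mass of a translate of the dual cone, by a vector short enough for the
translation to cost only a bounded factor. -/
lemma integral_indicator_translate_nonnegCone_ge {Z : Set E}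
    (hZ : ∀ y ∈ Z, ∀ z ∈ Z, 0 ≤ inner ℝ y z) {m : ℕ} (hm : Module.finrank ℝ E = m) (hm0 : 0 < m)
    {c : E} (hc : ‖c‖ ^ 2 ≤ 1 / (m + 2 : ℝ)) :
    Real.exp (-1 / 2) * (((m + 2 : ℝ) / m) ^ ((m : ℝ) / 2))⁻¹ * (Real.pi / 6) ^ ((m : ℝ) / 2) ≤
      ∫ θ : E, {θ | θ - c ∈ nonnegCone Z}.indicator (fun θ => Real.exp (-1 * ‖θ‖ ^ 2)) θ := by
  have hm' : (0 : ℝ) < m := by exact_mod_cast hm0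
  have hb : 0 < (m + 2 : ℝ) / m := by positivity
  have hS := (isClosed_nonnegCone Z).measurableSet
  rw [← integral_add_right_eq_self _ c]
  calc _ ≤ Real.exp (-1 / 2) * ∫ v in nonnegCone Z, Real.exp (-((m + 2 : ℝ) / m) * ‖v‖ ^ 2) := by
        rw [setIntegral_nonnegCone_scale Z hb, hm, mul_assoc]
        have := setIntegral_nonnegCone_ge hZ
        rw [hm] at this
        gcongr
    _ ≤ _ := by
        rw [← integral_indicator hS, ← integral_const_mul]
        refine integral_mono (((integrable_exp_neg_mul_sq_norm hb).indicator hS).const_mul _) ?_ ?_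
        · refine Integrable.comp_add_right (f := {θ | θ - c ∈ nonnegCone Z}.indicator
            (fun θ => Real.exp (-1 * ‖θ‖ ^ 2)))
            ((integrable_exp_neg_mul_sq_norm one_pos).indicator ?_) c
          exact measurableSet_preimage (measurable_id.sub_const c) hS
        · intro s
          by_cases hs : s ∈ nonnegCone Z
          · have h1 : s + c ∈ {θ | θ - c ∈ nonnegCone Z} := by simpa using hs
            simp only [indicator_of_mem hs, indicator_of_mem h1]
            rw [← Real.exp_add]
            refine Real.exp_le_exp.2 ?_
            -- `2 ⟪s, c⟫ ≤ (2 / m) ‖s‖² + (m / 2) ‖c‖²`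
            have e1 := norm_add_sq_real s c
            have e2 := norm_sub_sq_real ((2 / m : ℝ) • s) c
            rw [real_inner_smul_left, norm_smul, mul_pow, Real.norm_eq_abs, sq_abs] at e2
            have e3 : 0 ≤ (m / 2 : ℝ) * ‖(2 / m : ℝ) • s - c‖ ^ 2 := by positivity
            rw [e2] at e3
            have e4 : (m / 2 : ℝ) * ((2 / m : ℝ) ^ 2 * ‖s‖ ^ 2 -
                2 * ((2 / m : ℝ) * inner ℝ s c) + ‖c‖ ^ 2) =
                (2 / m : ℝ) * ‖s‖ ^ 2 - 2 * inner ℝ s c + (m / 2 : ℝ) * ‖c‖ ^ 2 := by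
              field_simp
            have e5 : (m + 2 : ℝ) * ‖c‖ ^ 2 ≤ 1 := by
              rw [le_div_iff₀ (by positivity)] at hc; linarith
            have e6 : (m + 2 : ℝ) / m * ‖s‖ ^ 2 = ‖s‖ ^ 2 + (2 / m : ℝ) * ‖s‖ ^ 2 := by
              field_simp
            linarith
          · have h1 : s + c ∉ {θ | θ - c ∈ nonnegCone Z} := by simpa using hs
            simp only [indicator_of_notMem hs, indicator_of_notMem h1, mul_zero, le_refl]

/-- The constants come from `r ≤ exp (κ r² - 1 / 2) / √(2 κ)` with `κ = 2 / (m + 2)`. -/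
lemma mul_exp_neg_sq_le (m : ℕ) (r : ℝ) :
    r * Real.exp (-1 * r ^ 2) ≤ Real.exp (-1 / 2) * (√(m + 2 : ℝ) / 2) *
      Real.exp (-((m : ℝ) / (m + 2)) * r ^ 2) := by
  have h1 : r ≤ √(m + 2 : ℝ) / 2 * Real.exp (2 / (m + 2 : ℝ) * r ^ 2 - 1 / 2) := by
    refine le_of_sq_le_sq ?_ (by positivity)
    rw [mul_pow, div_pow, Real.sq_sqrt (by positivity), ← Real.exp_nat_mul]
    have h2 := Real.add_one_le_exp (((2 : ℕ) : ℝ) * (2 / (m + 2 : ℝ) * r ^ 2 - 1 / 2))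
    calc r ^ 2 = (m + 2 : ℝ) / 2 ^ 2 * (((2 : ℕ) : ℝ) * (2 / (m + 2 : ℝ) * r ^ 2 - 1 / 2) + 1) := by
          push_cast; field_simp; ring
      _ ≤ _ := by gcongr
  calc r * Real.exp (-1 * r ^ 2)
      ≤ √(m + 2 : ℝ) / 2 * Real.exp (2 / (m + 2 : ℝ) * r ^ 2 - 1 / 2) * Real.exp (-1 * r ^ 2) := by
        gcongr
    _ = _ := by
        rw [mul_assoc, ← Real.exp_add, mul_right_comm, ← Real.exp_add, mul_comm]
        congr 2
        field_simp; ring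

end Cone

/-! ### Length of greedy projection paths -/

section Path

open MeasureTheory

variable {E : Type*} [NormedAddCommGroup E] [InnerProductSpace ℝ E]

/-- A path `x 0, …, x T` in which every step `x t → x (t + 1)` looks like a projection to a convex
set containing the rest of the path. -/
def IsProjectionPath (x : ℕ → E) (T : ℕ) : Prop :=
  ∀ t s, t < s → s ≤ T → inner ℝ (x t - x (t + 1)) (x s - x (t + 1)) ≤ 0

namespace IsProjectionPath

variable {x : ℕ → E} {T : ℕ}

lemma norm_step_sq_le (h : IsProjectionPath x T) {t s : ℕ} (hts : t < s) (hs : s ≤ T) :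
    ‖x (t + 1) - x t‖ ^ 2 ≤ inner ℝ (x (t + 1) - x t) (x s - x t) := by
  have h1 := h t s hts hs
  rw [← neg_sub (x (t + 1)) (x t), inner_neg_left] at h1
  rw [show x s - x t = (x s - x (t + 1)) + (x (t + 1) - x t) by abel, inner_add_right,
    real_inner_self_eq_norm_sq]
  linarith

lemma norm_sub_antitone (h : IsProjectionPath x T) {t k s : ℕ} (htk : t ≤ k) (hks : k ≤ s)
    (hs : s ≤ T) : ‖x s - x k‖ ≤ ‖x s - x t‖ := by
  induction k, htk using Nat.le_induction with
  | base => rfl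
  | succ k hk ih =>
    refine le_trans ?_ (ih (by omega))
    have h1 := h k s (by omega) hs
    have h2 := norm_sub_sq_real (x s - x (k + 1)) (x k - x (k + 1))
    rw [sub_sub_sub_cancel_right, real_inner_comm] at h2
    refine le_of_sq_le_sq ?_ (norm_nonneg _)
    nlinarith [sq_nonneg ‖x k - x (k + 1)‖]

/-- The rest of the path is seen from each of its points under angles of at most `π / 2`: in the
triangle `x t, x a, x b` with `t ≤ a ≤ b` the side from `x a` to `x b` is not longer than that from
`x t` to `x b`. -/
lemma inner_nonneg (h : IsProjectionPath x T) {t a b : ℕ} (hta : t ≤ a) (htb : t ≤ b) (ha : a ≤ T)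
    (hb : b ≤ T) : 0 ≤ inner ℝ (x a - x t) (x b - x t) := by
  wlog hab : a ≤ b generalizing a b
  · rw [real_inner_comm]; exact this htb hta hb ha (by omega)
  have h1 := h.norm_sub_antitone hta hab hb
  have h2 := norm_sub_sq_real (x b - x t) (x a - x t)
  rw [sub_sub_sub_cancel_right, real_inner_comm] at h2
  have h3 : ‖x b - x a‖ ^ 2 ≤ ‖x b - x t‖ ^ 2 := by gcongr
  nlinarith [sq_nonneg ‖x a - x t‖]

end IsProjectionPath

/-- The directions from `x t` to the later points of the path `x 0, …, x T`. -/
def laterDirections (x : ℕ → E) (T t : ℕ) : Set E := {z | ∃ s, t < s ∧ s ≤ T ∧ z = x s - x t}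

/-- The dual cone of `laterDirections x T t`, translated by `τ` along the direction of the step
from `x t` to `x (t + 1)`. For a projection path, each linear functional `θ` in it exceeds its
value at `x t` by at least `τ ‖x (t + 1) - x t‖` on the rest of the path. For a step of length zero
the junk value `0⁻¹ = 0` leaves the cone in place. -/
def shiftedCone (x : ℕ → E) (T : ℕ) (τ : ℝ) (t : ℕ) : Set E :=
  {θ | θ - (τ * ‖x (t + 1) - x t‖⁻¹) • (x (t + 1) - x t) ∈ nonnegCone (laterDirections x T t)}

lemma measurableSet_shiftedCone [MeasurableSpace E] [BorelSpace E] (x : ℕ → E) (T : ℕ) (τ : ℝ)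
    (t : ℕ) : MeasurableSet (shiftedCone x T τ t) :=
  measurableSet_preimage (measurable_id.sub_const _) (isClosed_nonnegCone _).measurableSet

/-- The part of the path length from time `k` to time `T`, scaled by `τ`, that is made of the steps
with `θ` in their shifted cone. -/
noncomputable def conePotential (x : ℕ → E) (T : ℕ) (τ : ℝ) (k : ℕ) (θ : E) : ℝ :=
  ∑ t ∈ Finset.Ico k T, (shiftedCone x T τ t).indicator (fun _ => τ * ‖x (t + 1) - x t‖) θ

namespace IsProjectionPath

variable {x : ℕ → E} {T : ℕ}

lemma le_inner_of_mem_shiftedCone (h : IsProjectionPath x T) {τ : ℝ} (hτ : 0 ≤ τ) {t s : ℕ}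
    (hts : t < s) (hs : s ≤ T) {θ : E} (hθ : θ ∈ shiftedCone x T τ t) :
    τ * ‖x (t + 1) - x t‖ ≤ inner ℝ θ (x s - x t) := by
  have h1 := hθ (x s - x t) ⟨s, hts, hs, rfl⟩
  have h2 := h.norm_step_sq_le hts hs
  rw [inner_sub_left, real_inner_smul_left] at h1
  rcases (norm_nonneg (x (t + 1) - x t)).eq_or_lt with h0 | h0
  · rw [← h0] at h1 ⊢; simpa using h1
  · have h3 : τ * ‖x (t + 1) - x t‖⁻¹ * ‖x (t + 1) - x t‖ ^ 2 ≤
        τ * ‖x (t + 1) - x t‖⁻¹ * inner ℝ (x (t + 1) - x t) (x s - x t) := by gcongr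
    have h4 : τ * ‖x (t + 1) - x t‖⁻¹ * ‖x (t + 1) - x t‖ ^ 2 = τ * ‖x (t + 1) - x t‖ := by
      field_simp
    linarith

/-- The steps with `θ` in their shifted cone are charged to the decrease, along the path, of the
minimum of the linear functional `θ` over the rest of the path. -/
lemma exists_conePotential_le (h : IsProjectionPath x T) {τ : ℝ} (hτ : 0 ≤ τ) (θ : E) {k : ℕ}
    (hk : k ≤ T) :
    ∃ s, k ≤ s ∧ s ≤ T ∧ conePotential x T τ k θ ≤ inner ℝ θ (x T - x s) := by
  induction hk using Nat.decreasingInduction with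
  | self => exact ⟨T, le_rfl, le_rfl, by simp [conePotential]⟩
  | of_succ k hk ih =>
    obtain ⟨s, hks, hsT, hs⟩ := ih
    have hsum : conePotential x T τ k θ =
        (shiftedCone x T τ k).indicator (fun _ => τ * ‖x (k + 1) - x k‖) θ +
          conePotential x T τ (k + 1) θ := Finset.sum_eq_sum_Ico_succ_bot hk _
    by_cases hθ : θ ∈ shiftedCone x T τ k
    · refine ⟨k, le_rfl, hk.le, ?_⟩
      have h1 := h.le_inner_of_mem_shiftedCone hτ hks hsT hθ
      rw [hsum, indicator_of_mem hθ, ← sub_add_sub_cancel (x T) (x s) (x k), inner_add_right]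
      linarith
    · refine ⟨s, by omega, hsT, ?_⟩
      rwa [hsum, indicator_of_notMem hθ, zero_add]

lemma conePotential_add_neg_le (h : IsProjectionPath x T) {τ D : ℝ} (hτ : 0 ≤ τ)
    (hD : ∀ s ≤ T, ∀ t ≤ T, ‖x s - x t‖ ≤ D) (θ : E) :
    conePotential x T τ 0 θ + conePotential x T τ 0 (-θ) ≤ D * ‖θ‖ := by
  obtain ⟨s, -, hs, h1⟩ := h.exists_conePotential_le hτ θ (Nat.zero_le T)
  obtain ⟨t, -, ht, h2⟩ := h.exists_conePotential_le hτ (-θ) (Nat.zero_le T)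
  have h3 : inner ℝ θ (x T - x s) + inner ℝ (-θ) (x T - x t) = inner ℝ θ (x t - x s) := by
    rw [inner_neg_left, ← sub_eq_add_neg, ← inner_sub_right]; congr 1; abel
  have h4 := real_inner_le_norm θ (x t - x s)
  have h5 : ‖θ‖ * ‖x t - x s‖ ≤ ‖θ‖ * D := by gcongr; exact hD t ht s hs
  linarith

variable [FiniteDimensional ℝ E] [MeasurableSpace E] [BorelSpace E]

lemma le_integral_indicator_shiftedCone (h : IsProjectionPath x T) {m : ℕ}
    (hm : Module.finrank ℝ E = m) (hm0 : 0 < m) (t : ℕ) :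
    Real.exp (-1 / 2) * (((m + 2 : ℝ) / m) ^ ((m : ℝ) / 2))⁻¹ * (Real.pi / 6) ^ ((m : ℝ) / 2) ≤
      ∫ θ : E, (shiftedCone x T (√(m + 2 : ℝ))⁻¹ t).indicator
        (fun θ => Real.exp (-1 * ‖θ‖ ^ 2)) θ := by
  refine integral_indicator_translate_nonnegCone_ge ?_ hm hm0 ?_
  · rintro _ ⟨a, hta, ha, rfl⟩ _ ⟨b, htb, hb, rfl⟩
    exact h.inner_nonneg hta.le htb.le ha hb
  · rw [norm_smul, mul_pow, Real.norm_eq_abs, sq_abs, mul_pow, inv_pow,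
      Real.sq_sqrt (by positivity), mul_assoc, ← mul_pow, one_div]
    refine mul_le_of_le_one_right (by positivity) (pow_le_one₀ (by positivity) ?_)
    exact inv_mul_le_one

/-- The length of a projection path of diameter at most `D` in dimension `m`. The integral of the
cone potential against the Gaussian bounds the length from above; by symmetrization, it is at most
half the Gaussian integral of `D ‖θ‖`. -/
theorem length_le (h : IsProjectionPath x T) {m : ℕ} (hm : Module.finrank ℝ E = m) (hm0 : 0 < m)
    {D : ℝ} (hD : ∀ s ≤ T, ∀ t ≤ T, ‖x s - x t‖ ≤ D) :
    ∑ t ∈ Finset.range T, ‖x (t + 1) - x t‖ ≤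
      (m + 2 : ℝ) / 4 * ((m + 2 : ℝ) / m) ^ m * 6 ^ ((m : ℝ) / 2) * D := by
  have hm' : (0 : ℝ) < m := by exact_mod_cast hm0
  have hD0 : 0 ≤ D := (norm_nonneg _).trans (hD 0 (Nat.zero_le _) 0 (Nat.zero_le _))
  set τ : ℝ := (√(m + 2 : ℝ))⁻¹ with hτdef
  have hτ : 0 < τ := by positivity
  set ℓ : ℝ := ∑ t ∈ Finset.range T, ‖x (t + 1) - x t‖
  let g : E → ℝ := fun θ => Real.exp (-1 * ‖θ‖ ^ 2)
  have hg : Integrable g := integrable_exp_neg_mul_sq_norm one_pos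
  set B : ℝ := Real.exp (-1 / 2) * (((m + 2 : ℝ) / m) ^ ((m : ℝ) / 2))⁻¹ *
    (Real.pi / 6) ^ ((m : ℝ) / 2) with hB
  have hind (t : ℕ) : Integrable ((shiftedCone x T τ t).indicator g) :=
    hg.indicator (measurableSet_shiftedCone x T τ t)
  have hφ (θ : E) : conePotential x T τ 0 θ * g θ = ∑ t ∈ Finset.range T,
      τ * ‖x (t + 1) - x t‖ * (shiftedCone x T τ t).indicator g θ := by
    rw [conePotential, Finset.sum_mul, Finset.range_eq_Ico]
    refine Finset.sum_congr rfl fun t _ => ?_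
    by_cases hθ : θ ∈ shiftedCone x T τ t
    · simp only [indicator_of_mem hθ]
    · simp only [indicator_of_notMem hθ, zero_mul, mul_zero]
  have hφint : Integrable fun θ => conePotential x T τ 0 θ * g θ := by
    simp_rw [hφ]
    exact integrable_finsetSum _ fun t _ => (hind t).const_mul _
  have hlower : τ * ℓ * B ≤ ∫ θ, conePotential x T τ 0 θ * g θ := by
    simp_rw [hφ]
    rw [integral_finsetSum _ fun t _ => (hind t).const_mul _, Finset.mul_sum, Finset.sum_mul]
    refine Finset.sum_le_sum fun t _ => ?_
    rw [integral_const_mul]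
    gcongr
    exact h.le_integral_indicator_shiftedCone hm hm0 t
  -- Symmetrization turns the two bounds by increments of `θ` and `-θ` into one by the diameter.
  have hsymm : ∫ θ, conePotential x T τ 0 (-θ) * g θ = ∫ θ, conePotential x T τ 0 θ * g θ := by
    rw [← integral_neg_eq_self]
    simp [g]
  have hφint' : Integrable fun θ => conePotential x T τ 0 (-θ) * g θ := by
    simpa [g] using hφint.comp_neg
  have hb : 0 < (m : ℝ) / (m + 2) := by positivity
  have hupper : 2 * ∫ θ, conePotential x T τ 0 θ * g θ ≤
      D * (Real.exp (-1 / 2) * (√(m + 2 : ℝ) / 2)) *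
        (Real.pi / ((m : ℝ) / (m + 2))) ^ ((m : ℝ) / 2) := by
    have hgauss := GaussianFourier.integral_rexp_neg_mul_sq_norm (V := E) hb
    rw [hm] at hgauss
    rw [two_mul]
    nth_rewrite 2 [← hsymm]
    rw [← integral_add hφint hφint', ← hgauss, ← integral_const_mul]
    refine integral_mono (hφint.add hφint') ((integrable_exp_neg_mul_sq_norm hb).const_mul _) ?_
    intro θ
    have h1 := h.conePotential_add_neg_le hτ.le hD θ
    have h2 := mul_exp_neg_sq_le m ‖θ‖
    have hg0 : 0 ≤ g θ := (Real.exp_pos _).le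
    calc conePotential x T τ 0 θ * g θ + conePotential x T τ 0 (-θ) * g θ
        ≤ D * ‖θ‖ * g θ := by rw [← add_mul]; gcongr
      _ ≤ _ := by
        rw [mul_assoc]
        refine (mul_le_mul_of_nonneg_left h2 hD0).trans_eq ?_
        ring
  -- Cancel the Gaussian normalization `exp (-1 / 2) π ^ (m / 2)`.
  set r : ℝ := (m + 2 : ℝ) / m with hr
  have hr0 : 0 < r := by positivity
  have e1 : (Real.pi / ((m : ℝ) / (m + 2))) ^ ((m : ℝ) / 2) =
      Real.pi ^ ((m : ℝ) / 2) * r ^ ((m : ℝ) / 2) := by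
    rw [← Real.mul_rpow Real.pi_pos.le hr0.le]
    congr 1
    rw [hr]; field_simp
  have e2 : r ^ m = r ^ ((m : ℝ) / 2) * r ^ ((m : ℝ) / 2) := by
    rw [← Real.rpow_add hr0, ← Real.rpow_natCast]; congr 1; ring
  have e3 : (Real.pi / 6) ^ ((m : ℝ) / 2) = Real.pi ^ ((m : ℝ) / 2) / 6 ^ ((m : ℝ) / 2) :=
    Real.div_rpow Real.pi_pos.le (by norm_num) _
  rw [e1] at hupper
  rw [hB, e3] at hlower
  rw [e2]
  have hp : 0 < Real.pi ^ ((m : ℝ) / 2) := by positivity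
  have hrp : 0 < r ^ ((m : ℝ) / 2) := by positivity
  have h6 : (0 : ℝ) < 6 ^ ((m : ℝ) / 2) := by positivity
  have hs : 0 < √(m + 2 : ℝ) := by positivity
  have hs2 : √(m + 2 : ℝ) * √(m + 2 : ℝ) = m + 2 := Real.mul_self_sqrt (by positivity)
  have he := Real.exp_pos (-1 / 2)
  have hfin := (mul_le_mul_of_nonneg_left hlower two_pos.le).trans hupper
  rw [hτdef] at hfin
  generalize Real.pi ^ ((m : ℝ) / 2) = p at *
  generalize r ^ ((m : ℝ) / 2) = R at *
  generalize (6 : ℝ) ^ ((m : ℝ) / 2) = S at *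
  generalize Real.exp (-1 / 2) = e at *
  generalize √(m + 2 : ℝ) = q at *
  rw [← hs2]
  have hc : 0 < 2 * (q⁻¹ * (e * R⁻¹ * (p / S))) := by positivity
  refine le_of_mul_le_mul_left (hfin.trans' (le_of_eq ?_) |>.trans (le_of_eq ?_)) hc
  · ring
  · field_simp
    ring

end IsProjectionPath

end Path

/-! ### The space of symmetric matrices -/

section TriNorm

variable {n : ℕ}

/-- The upper triangle (diagonal included) of a matrix, as a vector of a Euclidean space of
dimension `n (n + 1) / 2`. -/
noncomputable def triVec (n : ℕ) : Matrix (Fin n) (Fin n) ℝ →ₗ[ℝ]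
    EuclideanSpace ℝ (Σ i : Fin n, Finset.Ici i) where
  toFun A := WithLp.toLp 2 fun p => A p.1 p.2
  map_add' _ _ := rfl
  map_smul' _ _ := rfl

lemma norm_triVec (A : Matrix (Fin n) (Fin n) ℝ) : ‖triVec n A‖ = triNorm A := by
  rw [EuclideanSpace.norm_eq, triNorm, Fintype.sum_sigma]
  congr 1
  refine Finset.sum_congr rfl fun i _ => ?_
  rw [← Finset.sum_coe_sort (Finset.Ici i)]
  refine Finset.sum_congr rfl fun j _ => ?_
  rw [Real.norm_eq_abs, sq_abs]
  rfl

lemma card_upperTriangle (n : ℕ) : Fintype.card (Σ i : Fin n, Finset.Ici i) = symDim n := by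
  simp only [Fintype.card_sigma, Fintype.card_coe, Fin.card_Ici]
  rw [Fin.sum_univ_eq_sum_range (fun i => n - i) n, symDim]
  have h : ∑ i ∈ Finset.range n, (n - i) = ∑ i ∈ Finset.range (n + 1), i := by
    rw [Finset.sum_range_succ', add_zero, ← Finset.sum_range_reflect]
    refine Finset.sum_congr rfl fun i hi => ?_
    rw [Finset.mem_range] at hi
    omega
  rw [h, Finset.sum_range_id, Nat.add_sub_cancel, mul_comm]

lemma finrank_triVec (n : ℕ) :
    Module.finrank ℝ (EuclideanSpace ℝ (Σ i : Fin n, Finset.Ici i)) = symDim n := by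
  rw [finrank_euclideanSpace, card_upperTriangle]

lemma triNorm_nonneg (A : Matrix (Fin n) (Fin n) ℝ) : 0 ≤ triNorm A := Real.sqrt_nonneg _

lemma triNorm_sub_comm (A B : Matrix (Fin n) (Fin n) ℝ) : triNorm (A - B) = triNorm (B - A) := by
  rw [← norm_triVec, ← norm_triVec, map_sub, map_sub, norm_sub_rev]

lemma triNorm_sub_le_triDiam {S : Set (Matrix (Fin n) (Fin n) ℝ)} (hS : IsCompact S)
    {X Y : Matrix (Fin n) (Fin n) ℝ} (hX : X ∈ S) (hY : Y ∈ S) : triNorm (X - Y) ≤ triDiam S := by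
  have hcont : Continuous fun p : Matrix (Fin n) (Fin n) ℝ × Matrix (Fin n) (Fin n) ℝ =>
      triNorm (p.1 - p.2) := by
    simp_rw [← norm_triVec]
    exact (triVec n).continuous_of_finiteDimensional.norm.comp (continuous_fst.sub continuous_snd)
  refine le_csSup (((hS.prod hS).image hcont).bddAbove.mono ?_) ⟨X, hX, Y, hY, rfl⟩
  rintro _ ⟨X₁, h₁, X₂, h₂, rfl⟩
  exact ⟨(X₁, X₂), ⟨h₁, h₂⟩, rfl⟩

/-- Every row of a symmetric matrix is made of distinct entries of its upper triangle. -/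
lemma sum_row_sq_le {A : Matrix (Fin n) (Fin n) ℝ} (hA : A.IsSymm) (i : Fin n) :
    ∑ j, A i j ^ 2 ≤ triNorm A ^ 2 := by
  rw [triNorm, Real.sq_sqrt (by positivity), Finset.sum_sigma' Finset.univ fun i => Finset.Ici i]
  let φ (j : Fin n) : Σ _ : Fin n, Fin n := ⟨min i j, max i j⟩
  have hφ : Function.Injective φ := fun j k h => by
    simp only [φ, Sigma.mk.injEq, heq_eq_eq] at h
    grind
  calc ∑ j, A i j ^ 2 = ∑ p ∈ Finset.univ.image φ, A p.1 p.2 ^ 2 := by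
        rw [Finset.sum_image hφ.injOn]
        refine Finset.sum_congr rfl fun j _ => ?_
        rcases le_total i j with h | h
        · simp only [φ, min_eq_left h, max_eq_right h]
        · simp only [φ, min_eq_right h, max_eq_left h, hA.apply i j]
    _ ≤ _ := by
        refine Finset.sum_le_sum_of_subset_of_nonneg (fun p hp => ?_) fun p _ _ => sq_nonneg _
        obtain ⟨j, -, rfl⟩ := Finset.mem_image.1 hp
        simp [φ]

lemma abs_mulVec_le {A : Matrix (Fin n) (Fin n) ℝ} (hA : A.IsSymm) (x : Fin n → ℝ) (i : Fin n) :
    |(A *ᵥ x) i| ≤ triNorm A * l2norm x := by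
  refine abs_le_of_sq_le_sq ?_ (mul_nonneg (triNorm_nonneg A) (norm_nonneg _))
  have h1 := Finset.sum_mul_sq_le_sq_mul_sq Finset.univ (A i) x
  have h2 : l2norm x ^ 2 = ∑ j, x j ^ 2 := by
    rw [l2norm, EuclideanSpace.norm_sq_eq]; simp
  rw [mul_pow, h2]
  refine h1.trans ?_
  gcongr
  exact sum_row_sq_le hA i

/-- The constant of `IsProjectionPath.length_le` in dimension `n (n + 1) / 2`. The case `n = 2`
stands apart because `6 ^ (m / 2) ≤ m ^ (m / 2)` fails for `m = 3`. -/
lemma length_const_le {n : ℕ} (hn : 2 ≤ n) :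
    (symDim n + 2 : ℝ) / 4 * ((symDim n + 2 : ℝ) / symDim n) ^ symDim n *
      6 ^ ((symDim n : ℝ) / 2) ≤ 4 * gammaConst n - 1 := by
  have hpi := Real.pi_gt_three
  rcases hn.eq_or_lt with rfl | hn
  · have hm : symDim 2 = 3 := rfl
    rw [gammaConst, hm]
    have h3 (b : ℝ) (hb : 0 < b) : b ^ (((3 : ℕ) : ℝ) / 2) = b * √b := by
      rw [Real.sqrt_eq_rpow, ← Real.rpow_one_add' hb.le (by norm_num)]; norm_num
    have hc : (((3 : ℕ) : ℝ)) ^ (((3 : ℕ) : ℝ) / 2) = 3 * √3 := by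
      rw [h3 _ (by norm_num)]; norm_num
    rw [h3 6 (by norm_num), hc]
    have h6 : √6 ≤ 2.45 := by rw [Real.sqrt_le_left (by norm_num)]; norm_num
    have h3' : 1.7 ≤ √3 := Real.le_sqrt_of_sq_le (by norm_num)
    norm_num
    nlinarith [mul_le_mul hpi.le h3' (by norm_num) (by positivity)]
  · have hm : 6 ≤ symDim n := by
      rw [symDim, Nat.le_div_iff_mul_le two_pos]; nlinarith
    rw [gammaConst]
    generalize symDim n = m at hm
    have hm' : (6 : ℝ) ≤ m := by exact_mod_cast hm
    have h1 : ((m + 2 : ℝ) / m) ^ m ≤ 7.4 := by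
      have h := Real.add_one_le_exp (2 / m : ℝ)
      have he := Real.exp_one_lt_d9
      calc ((m + 2 : ℝ) / m) ^ m = (2 / m + 1 : ℝ) ^ m := by congr 1; field_simp; ring
        _ ≤ Real.exp (2 / m : ℝ) ^ m := by gcongr
        _ = Real.exp 1 ^ 2 := by
          rw [← Real.exp_nat_mul, ← Real.exp_nat_mul]; congr 1; field_simp; norm_num
        _ ≤ 2.7182818286 ^ 2 := by gcongr
        _ ≤ 7.4 := by norm_num
    have h2 : (6 : ℝ) ^ ((m : ℝ) / 2) ≤ (m : ℝ) ^ ((m : ℝ) / 2) :=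
      Real.rpow_le_rpow (by norm_num) hm' (by positivity)
    have h3 : 1 ≤ (m : ℝ) ^ ((m : ℝ) / 2) := Real.one_le_rpow (by linarith) (by positivity)
    generalize (m : ℝ) ^ ((m : ℝ) / 2) = M at h2 h3
    calc (m + 2 : ℝ) / 4 * ((m + 2 : ℝ) / m) ^ m * 6 ^ ((m : ℝ) / 2)
        ≤ (m + 2 : ℝ) / 4 * 7.4 * M := by gcongr
      _ ≤ 4 * (3 * (m - 1) * M) - 1 := by nlinarith
      _ ≤ 4 * (Real.pi * (m - 1) * M) - 1 := by
        have : 0 ≤ (m - 1 : ℝ) := by linarith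
        gcongr

end TriNorm

/-! ### Greedy projection model chasing -/

section Chasing

variable {n : ℕ} {I : Input n}

lemma convex_consistentSet (hX : Convex ℝ I.modelSet) (hV : Convex ℝ I.vparSet)
    (D : List (Observation n)) : Convex ℝ (I.consistentSet D) := by
  intro X hXm Y hYm a b ha hb hab
  refine ⟨hX hXm.1 hYm.1 ha hb hab, fun d hd => ?_⟩
  have key (p q : Fin n → ℝ) : p - (a • X + b • Y) *ᵥ q = a • (p - X *ᵥ q) + b • (p - Y *ᵥ q) := by
    rw [add_mulVec, smul_mulVec, smul_mulVec]
    nth_rewrite 1 [← one_smul ℝ p]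
    rw [← hab]
    module
  rw [key, key]
  exact ⟨convex_Icc _ _ (hXm.2 d hd).1 (hYm.2 d hd).1 ha hb hab,
    hV (hXm.2 d hd).2 (hYm.2 d hd).2 ha hb hab⟩

lemma consistentSet_anti {D D' : List (Observation n)} (h : D ⊆ D') :
    I.consistentSet D' ⊆ I.consistentSet D :=
  fun _ hX => ⟨hX.1, fun d hd => hX.2 d (h hd)⟩

lemma mem_trajectory {v u qc : ℕ → Fin n → ℝ} {t i : ℕ} (hi : i < t) :
    (⟨v (i + 1), v (i + 2), u (i + 1), qc (i + 1)⟩ : Observation n) ∈ trajectory v u qc t :=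
  List.mem_map.2 ⟨i, List.mem_range.2 hi, rfl⟩

lemma trajectory_subset (v u qc : ℕ → Fin n → ℝ) {s t : ℕ} (h : s ≤ t) :
    trajectory v u qc s ⊆ trajectory v u qc t := by
  intro d hd
  obtain ⟨i, hi, rfl⟩ := List.mem_map.1 hd
  exact mem_trajectory ((List.mem_range.1 hi).trans_le h)

lemma Input.IsSEL.inner_le_zero (hX : Convex ℝ I.modelSet) (hV : Convex ℝ I.vparSet)
    {D : List (Observation n)} {X Y Z : Matrix (Fin n) (Fin n) ℝ} (h : I.IsSEL D X Y)
    (hZ : Z ∈ I.consistentSet D) :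
    inner ℝ (triVec n X - triVec n Y) (triVec n Z - triVec n Y) ≤ 0 := by
  have hconv := (convex_consistentSet hX hV D).linear_image (triVec n)
  refine (norm_eq_iInf_iff_real_inner_le_zero hconv (mem_image_of_mem _ h.1)).1 ?_ _
    (mem_image_of_mem _ hZ)
  have : Nonempty (triVec n '' I.consistentSet D) := ⟨⟨_, mem_image_of_mem _ h.1⟩⟩
  refine le_antisymm (le_ciInf ?_) (ciInf_le ⟨0, ?_⟩
    (⟨_, mem_image_of_mem _ h.1⟩ : triVec n '' I.consistentSet D))
  · rintro ⟨_, W, hW, rfl⟩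
    have h1 : triNorm (Y - X) ^ 2 ≤ triNorm (W - X) ^ 2 := isMinOn_iff.1 h.2 W hW
    rw [← map_sub, ← map_sub, norm_triVec, norm_triVec, triNorm_sub_comm X, triNorm_sub_comm X]
    exact le_of_sq_le_sq h1 (triNorm_nonneg _)
  · rintro _ ⟨_, rfl⟩
    exact norm_nonneg _

end Chasing

/-! ### The robust control oracle -/

section Oracle

variable {n : ℕ} {I : Input n}

lemma Input.IsOracleAction.add_mem_Icc {X : Matrix (Fin n) (Fin n) ℝ} {v q u : Fin n → ℝ}
    (h : I.IsOracleAction X v q u) : q + u ∈ Icc I.qmin I.qmax := by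
  rcases h with h | ⟨-, ξ, h, -⟩
  · exact h.2.1.1
  · exact h.2.1

lemma l2norm_sub_le {a b p q : Fin n → ℝ} (hp : p ∈ Icc a b) (hq : q ∈ Icc a b) :
    l2norm (p - q) ≤ l2norm (b - a) := by
  rw [l2norm, l2norm, EuclideanSpace.norm_eq, EuclideanSpace.norm_eq]
  refine Real.sqrt_le_sqrt (Finset.sum_le_sum fun i _ => ?_)
  simp only [Real.norm_eq_abs, sq_abs, Pi.sub_apply]
  have := hp.1 i; have := hp.2 i; have := hq.1 i; have := hq.2 i
  refine sq_le_sq' ?_ ?_ <;> linarith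

lemma l2norm_sub_pos (hq : I.qmin ≠ I.qmax) : 0 < l2norm (I.qmax - I.qmin) := by
  rw [l2norm, norm_pos_iff, ne_eq, WithLp.toLp_eq_zero, sub_eq_zero]
  exact hq.symm

lemma rho_pos (hq : I.qmin ≠ I.qmax) (hε : 0 < I.ε) : 0 < I.rho :=
  div_pos hε (mul_pos two_pos (l2norm_sub_pos hq))

lemma rho_mul_l2norm_le (hq : I.qmin ≠ I.qmax) (hε : 0 < I.ε) {p q : Fin n → ℝ}
    (hp : p ∈ Icc I.qmin I.qmax) (hq' : q ∈ Icc I.qmin I.qmax) :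
    I.rho * l2norm (p - q) ≤ I.ε / 2 := by
  have h0 := l2norm_sub_pos hq
  calc I.rho * l2norm (p - q) ≤ I.rho * l2norm (I.qmax - I.qmin) :=
        mul_le_mul_of_nonneg_left (l2norm_sub_le hp hq') (rho_pos hq hε).le
    _ = I.ε / 2 := by rw [Input.rho]; field_simp

/-- The padding `ε` pays twice `ρ ‖u‖₂` for every `u` connecting two admissible injections: once for
the robustness margin `ρ ‖u‖₂`, once for a model error of norm at most `ρ`. -/
lemma oracleFeasible_nonempty {vpar : ℕ → Fin n → ℝ} (hq : I.qmin ≠ I.qmax)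
    (hpad : I.PaddedFeasible vpar) {X Y : Matrix (Fin n) (Fin n) ℝ} (hY : Y ∈ I.modelSet)
    (hsymm : (X - Y).IsSymm) (hXY : triNorm (X - Y) ≤ I.rho) {v q : Fin n → ℝ}
    (hq' : q ∈ Icc I.qmin I.qmax) (hv : v - Y *ᵥ q ∈ I.vparSet) :
    (I.oracleFeasible X v q).Nonempty := by
  obtain ⟨p, hp, hl, hu⟩ := hpad.feasible _ hv Y hY
  have hρ := rho_mul_l2norm_le hq hpad.eps_pos hp hq'
  have hEq : v + X *ᵥ (p - q) = Y *ᵥ p + (v - Y *ᵥ q) + (X - Y) *ᵥ (p - q) := by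
    simp only [sub_mulVec, mulVec_sub]; abel
  have herr (i) : |((X - Y) *ᵥ (p - q)) i| ≤ I.ε / 2 :=
    (abs_mulVec_le hsymm _ i).trans
      ((mul_le_mul_of_nonneg_right hXY (norm_nonneg _)).trans hρ)
  refine ⟨p - q, by rwa [add_sub_cancel], ?_⟩
  rw [hEq]
  constructor <;> intro i
  · have h1 := hl i
    have h2 := abs_le.1 (herr i)
    simp only [Pi.add_apply, constVec] at h1 ⊢
    linarith
  · have h1 := hu i
    have h2 := abs_le.1 (herr i)
    simp only [Pi.add_apply, Pi.sub_apply, constVec] at h1 ⊢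
    linarith

/-- If the oracle is feasible without slack for the model `X`, then the next voltage can leave its
limits only if every model consistent with the step is farther than `ρ` from `X`. -/
lemma next_mem_Icc {X Y : Matrix (Fin n) (Fin n) ℝ} {v v' q u : Fin n → ℝ}
    (hfeas : (I.oracleFeasible X v q).Nonempty) (hu : I.IsOracleAction X v q u)
    (hsymm : (Y - X).IsSymm) (hXY : triNorm (Y - X) ≤ I.rho)
    (hY : v' - v - Y *ᵥ u ∈ Icc (constVec n (-I.η)) (constVec n I.η)) :
    v' ∈ Icc I.vmin I.vmax := by
  obtain ⟨-, hl, hr⟩ : I.OracleConstraints X v q u 0 := by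
    rcases hu with h | h
    · exact h.2.1
    · exact absurd hfeas h.1
  have herr (i) : |((Y - X) *ᵥ u) i| ≤ I.rho * l2norm u :=
    (abs_mulVec_le hsymm u i).trans (mul_le_mul_of_nonneg_right hXY (norm_nonneg _))
  constructor <;> intro i
  all_goals
    have h1 := hl i
    have h2 := hr i
    have h3 := abs_le.1 (herr i)
    have h4 := hY.1 i
    have h5 := hY.2 i
    simp only [sub_mulVec, Pi.add_apply, Pi.sub_apply, constVec] at h1 h2 h3 h4 h5
    linarith

end Oracle

/-! ### Counting violations -/

namespace IsRun

variable {n : ℕ} {I : Input n} {Xstar : Matrix (Fin n) (Fin n) ℝ} {vpar : ℕ → Fin n → ℝ}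
  {Xhat : ℕ → Matrix (Fin n) (Fin n) ℝ} {v u qc : ℕ → Fin n → ℝ}

lemma qc_mem (hrun : IsRun I Xstar vpar Xhat v u qc) : ∀ t, qc t ∈ Icc I.qmin I.qmax
  | 0 => hrun.qc_init
  | t + 1 => by
    rw [hrun.qc_step (t + 1) (by omega)]
    exact (hrun.oracle (t + 1) (by omega)).add_mem_Icc

lemma Xhat_mem_consistentSet (hrun : IsRun I Xstar vpar Xhat v u qc) {s t : ℕ} (hs : 1 ≤ s)
    (hst : s < t) : Xhat t ∈ I.consistentSet (trajectory v u qc s) := by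
  obtain ⟨t, rfl⟩ : ∃ k, t = k + 1 := ⟨t - 1, by omega⟩
  exact consistentSet_anti (trajectory_subset v u qc (by omega)) (hrun.sel t (by omega)).1

lemma Xhat_mem (hrun : IsRun I Xstar vpar Xhat v u qc) {t : ℕ} (ht : 1 ≤ t) :
    Xhat t ∈ I.modelSet := by
  rcases ht.eq_or_lt with rfl | ht
  · exact hrun.Xhat_init
  · exact (hrun.Xhat_mem_consistentSet le_rfl ht).1

lemma isProjectionPath (hrun : IsRun I Xstar vpar Xhat v u qc) (hX : Convex ℝ I.modelSet)
    (hV : Convex ℝ I.vparSet) (T : ℕ) :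
    IsProjectionPath (fun t => triVec n (Xhat (t + 1))) T := fun t s hts _ =>
  (hrun.sel (t + 1) (by omega)).inner_le_zero hX hV
    (hrun.Xhat_mem_consistentSet (by omega) (by omega))

lemma sum_triNorm_le (hrun : IsRun I Xstar vpar Xhat v u qc) (hn : 2 ≤ n)
    (hX : IsCompact I.modelSet) (hX' : Convex ℝ I.modelSet) (hV : Convex ℝ I.vparSet) (T : ℕ) :
    ∑ t ∈ Finset.range T, triNorm (Xhat (t + 2) - Xhat (t + 1)) ≤
      (4 * gammaConst n - 1) * triDiam I.modelSet := by
  have hdiam {s t : ℕ} : triNorm (Xhat (s + 1) - Xhat (t + 1)) ≤ triDiam I.modelSet :=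
    triNorm_sub_le_triDiam hX (hrun.Xhat_mem (by omega)) (hrun.Xhat_mem (by omega))
  have hm : 0 < symDim n := by
    rw [symDim, Nat.div_pos_iff]; constructor <;> nlinarith
  have h := (hrun.isProjectionPath hX' hV T).length_le (finrank_triVec n) hm
    (D := triDiam I.modelSet) fun s _ t _ => by
      rw [← map_sub, norm_triVec]; exact hdiam
  simp only [← map_sub, norm_triVec] at h
  exact h.trans (mul_le_mul_of_nonneg_right (length_const_le hn)
    ((triNorm_nonneg _).trans (hdiam (s := 0) (t := 0))))

/-- From time `2` on, the estimated model explains the current voltage by an exogenous vector in the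
uncertainty set, so the oracle is feasible. -/
lemma oracleFeasible_nonempty (hrun : IsRun I Xstar vpar Xhat v u qc) (hq : I.qmin ≠ I.qmax)
    (hpad : I.PaddedFeasible vpar) {t : ℕ} (ht : 1 < t) :
    (I.oracleFeasible (Xhat t) (v t) (qc (t - 1))).Nonempty := by
  obtain ⟨t, rfl⟩ : ∃ k, t = k + 2 := ⟨t - 2, by omega⟩
  refine VoltageControl.oracleFeasible_nonempty (Y := Xhat (t + 2)) hq hpad
    (hrun.Xhat_mem (by omega)) ?_ ?_
    (hrun.qc_mem _) ((hrun.Xhat_mem_consistentSet (s := t + 1) (by omega) (by omega)).2 _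
      (mem_trajectory t.lt_succ_self)).2
  · rw [sub_self]; exact isSymm_zero
  · rw [sub_self, ← norm_triVec, map_zero, norm_zero]; exact (rho_pos hq hpad.eps_pos).le

lemma isSymm_sub (hmodel : I.ModelUncertainty Xstar) {X Y : Matrix (Fin n) (Fin n) ℝ}
    (hX : X ∈ I.modelSet) (hY : Y ∈ I.modelSet) : (X - Y).IsSymm := by
  have h (Z) (hZ : Z ∈ I.modelSet) : Z.IsSymm := by
    have := (hmodel.posSemidef Z hZ).isHermitian
    rwa [IsHermitian, conjTranspose_eq_transpose_of_trivial] at this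
  exact (h X hX).sub (h Y hY)

lemma mem_Icc_succ (hrun : IsRun I Xstar vpar Xhat v u qc) (hmodel : I.ModelUncertainty Xstar)
    {t : ℕ} (ht : 1 ≤ t) (hfeas : (I.oracleFeasible (Xhat t) (v t) (qc (t - 1))).Nonempty)
    (hstep : triNorm (Xhat (t + 1) - Xhat t) ≤ I.rho) : v (t + 1) ∈ Icc I.vmin I.vmax := by
  obtain ⟨k, rfl⟩ : ∃ k, t = k + 1 := ⟨t - 1, by omega⟩
  exact next_mem_Icc hfeas (hrun.oracle _ ht)
    (isSymm_sub hmodel (hrun.Xhat_mem (by omega)) (hrun.Xhat_mem ht)) hstep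
    ((hrun.Xhat_mem_consistentSet (s := k + 1) ht (by omega)).2 _
      (mem_trajectory k.lt_succ_self)).1

/-- An infeasible first oracle problem reveals an initial model error larger than `ρ`. -/
lemma rho_lt_triDiam (hrun : IsRun I Xstar vpar Xhat v u qc) (hq : I.qmin ≠ I.qmax)
    (hmodel : I.ModelUncertainty Xstar) (hpad : I.PaddedFeasible vpar)
    (h : ¬ (I.oracleFeasible (Xhat 1) (v 1) (qc 0)).Nonempty) : I.rho < triDiam I.modelSet := by
  by_contra! hle
  refine h (VoltageControl.oracleFeasible_nonempty hq hpad hmodel.true_mem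
    (isSymm_sub hmodel hrun.Xhat_init hmodel.true_mem)
    ((triNorm_sub_le_triDiam hmodel.compact hrun.Xhat_init hmodel.true_mem).trans hle)
    hrun.qc_init ?_)
  rw [hrun.v_init, add_sub_cancel_left]
  exact hpad.mem 0

/-- Voltages can leave the limits at time `1`, at time `2` if the first oracle problem is
infeasible, and after steps of the estimate longer than `ρ`. -/
lemma card_violations_le (hrun : IsRun I Xstar vpar Xhat v u qc) (hn : 2 ≤ n)
    (hq : I.qmin ≠ I.qmax) (hmodel : I.ModelUncertainty Xstar) (hpad : I.PaddedFeasible vpar)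
    (F : Finset ℕ) (hF : ∀ t ∈ F, 1 ≤ t ∧ v t ∉ Icc I.vmin I.vmax) :
    (F.card : ℝ) ≤ 4 * gammaConst n / I.rho * triDiam I.modelSet + 1 := by
  have hρ := rho_pos hq hpad.eps_pos
  have hD : 0 ≤ triDiam I.modelSet := (triNorm_nonneg _).trans
    (triNorm_sub_le_triDiam hmodel.compact hmodel.true_mem hmodel.true_mem)
  obtain ⟨T, hT⟩ := F.exists_nat_subset_range
  let G := (Finset.range T).filter fun t => I.rho < triNorm (Xhat (t + 2) - Xhat (t + 1))
  have hG : (G.card : ℝ) * I.rho ≤ (4 * gammaConst n - 1) * triDiam I.modelSet := by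
    refine le_trans ?_ (hrun.sum_triNorm_le hn hmodel.compact hmodel.convex hpad.convex T)
    rw [← nsmul_eq_mul]
    exact (Finset.card_nsmul_le_sum G _ _ fun t ht => (Finset.mem_filter.1 ht).2.le).trans
      (Finset.sum_le_sum_of_subset_of_nonneg (Finset.filter_subset _ _)
        fun _ _ _ => triNorm_nonneg _)
  have hcover {t : ℕ} (ht : t + 2 ∈ F)
      (hfeas : (I.oracleFeasible (Xhat (t + 1)) (v (t + 1)) (qc t)).Nonempty) : t ∈ G := by
    have htT := Finset.mem_range.1 (hT ht)
    refine Finset.mem_filter.2 ⟨Finset.mem_range.2 (by omega), ?_⟩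
    by_contra! hle
    exact (hF _ ht).2 (hrun.mem_Icc_succ hmodel (by omega) hfeas hle)
  have hlater {t : ℕ} (ht : t + 3 ∈ F) : t + 1 ∈ G :=
    hcover ht (hrun.oracleFeasible_nonempty hq hpad (by omega))
  have hinj : (G.image (· + 2)).card ≤ G.card := Finset.card_image_le
  suffices hcard : (F.card : ℝ) ≤ G.card + triDiam I.modelSet / I.rho + 1 by
    refine hcard.trans ?_
    have : (G.card : ℝ) ≤ (4 * gammaConst n - 1) * triDiam I.modelSet / I.rho :=
      (le_div_iff₀ hρ).2 hG
    calc _ ≤ (4 * gammaConst n - 1) * triDiam I.modelSet / I.rho +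
          triDiam I.modelSet / I.rho + 1 := by gcongr
      _ = _ := by ring
  by_cases h1 : (I.oracleFeasible (Xhat 1) (v 1) (qc 0)).Nonempty
  · have hsub : F ⊆ insert 1 (G.image (· + 2)) := by
      intro t ht
      obtain _ | _ | _ | t := t
      · exact absurd (hF 0 ht).1 (by omega)
      · simp
      · exact Finset.mem_insert_of_mem (Finset.mem_image_of_mem (· + 2) (hcover ht h1))
      · exact Finset.mem_insert_of_mem (Finset.mem_image_of_mem (· + 2) (hlater ht))
    have h2 : F.card ≤ G.card + 1 :=
      (Finset.card_le_card hsub).trans ((Finset.card_insert_le _ _).trans (by omega))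
    have h3 : (F.card : ℝ) ≤ G.card + 1 := by exact_mod_cast h2
    have h4 : 0 ≤ triDiam I.modelSet / I.rho := by positivity
    linarith
  · have hsub : F ⊆ insert 1 (insert 2 (G.image (· + 2))) := by
      intro t ht
      obtain _ | _ | _ | t := t
      · exact absurd (hF 0 ht).1 (by omega)
      · simp
      · simp
      · exact Finset.mem_insert_of_mem
          (Finset.mem_insert_of_mem (Finset.mem_image_of_mem (· + 2) (hlater ht)))
    have h2 : F.card ≤ G.card + 1 + 1 := (Finset.card_le_card hsub).trans
      ((Finset.card_insert_le _ _).trans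
        (Nat.succ_le_succ ((Finset.card_insert_le _ _).trans (by omega))))
    have h3 : (F.card : ℝ) ≤ G.card + 1 + 1 := by exact_mod_cast h2
    have h4 : 1 ≤ triDiam I.modelSet / I.rho :=
      (one_le_div hρ).2 (hrun.rho_lt_triDiam hq hmodel hpad h1).le
    linarith

end IsRun

end VoltageControl

theorem theorem1 {n : ℕ} (hn : 2 ≤ n) (I : VoltageControl.Input n)
    (hPv : I.Pv.PosSemidef) (hPu : I.Pu.PosSemidef) (hβ : 0 < I.β) (hq : I.qmin ≠ I.qmax)
    (Xstar : Matrix (Fin n) (Fin n) ℝ) (vpar : ℕ → Fin n → ℝ)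
    (hnoise : I.NoiseBounded vpar) (hmodel : I.ModelUncertainty Xstar)
    (hpad : I.PaddedFeasible vpar)
    (Xhat : ℕ → Matrix (Fin n) (Fin n) ℝ) (v u qc : ℕ → Fin n → ℝ)
    (hrun : VoltageControl.IsRun I Xstar vpar Xhat v u qc) :
    {t : ℕ | 1 ≤ t ∧ v t ∉ Set.Icc I.vmin I.vmax}.Finite ∧
      (({t : ℕ | 1 ≤ t ∧ v t ∉ Set.Icc I.vmin I.vmax}.ncard : ℕ) : ℝ) ≤
        4 * VoltageControl.gammaConst n / I.rho * VoltageControl.triDiam I.modelSet + 1 := by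
  have hcard := hrun.card_violations_le hn hq hmodel hpad
  have hfin : {t : ℕ | 1 ≤ t ∧ v t ∉ Set.Icc I.vmin I.vmax}.Finite := by
    by_contra hinf
    obtain ⟨k, hk⟩ := exists_nat_gt
      (4 * VoltageControl.gammaConst n / I.rho * VoltageControl.triDiam I.modelSet + 1)
    obtain ⟨F, hF, rfl⟩ := Set.Infinite.exists_subset_card_eq hinf k
    exact absurd (hcard F fun t ht => hF ht) (not_le.2 hk)
  refine ⟨hfin, ?_⟩
  rw [Set.ncard_eq_toFinset_card _ hfin]
  exact hcard _ fun t ht => by simpa using ht
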